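/- **Conventions.** All notions are bicategorical. A biadjunction $L\dashv R$ consists of pseudofunctors $L,R$, pseudonatural transformations $\mathrm{ID}\Rightarrow RL$ (unit) and $LR\Rightarrow\mathrm{ID}$ (counit), and invertible modifications filling the two triangles (no coherence equations between these modifications are required). A pseudofunctor is fully faithful if its local functors $\mathrm{Hom}(X,Y)\to\mathrm{Hom}(GX,GY)$ are equivalences of categories; its essential image consists of the objects equivalent to some $GX$. An inverter of a 2-morphism $\phi\colon f_1\Rightarrow f_2$, $f_1,f_2\colon X_1\to X_2$, is a 1-morphism $f_0\colon X_0\to X_1$ such that $\phi*f_0$ is invertible and, for every object $W$, composition with $f_0$ is an equivalence from $\mathrm{Hom}(W,X_0)$ to the full subcategory of $\mathrm{Hom}(W,X_1)$ on the $f$ with $\phi*f$ invertible. A 1-morphism $f\colon X\to Y$ is pseudomonic if, for every $W$, the functor $f\circ-\colon\mathrm{Hom}(W,X)\to\mathrm{Hom}(W,Y)$ is faithful and full on isomorphisms. **Theorem.** Let $\mathcal A,\mathcal B,\mathcal C$ be bicategories, $F\colon\mathcal A\to\mathcal B$ and $H\colon\mathcal A\to\mathcal C$ pseudofunctors with left biadjoints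 $L\dashv F$ and $N\dashv H$, $G\colon\mathcal B\to\mathcal C$ a pseudofunctor, and $\Gamma\colon GF\simeq H$ a pseudonatural equivalence. Let $\Psi\colon\mathrm{ID}_{\mathcal C}\Rightarrow HN$ be the unit of $N\dashv H$. Write $\Psi_{HN},(HN)\Psi\colon HN\Rightarrow(HN)(HN)$ for the pseudonatural transformations with components $\Psi_{HN(C)}$ and $HN(\Psi_C)$. Assume that $G$ is fully faithful and that: 1. there is a modification $\mu'\colon\Psi_{HN}\Rrightarrow(HN)\Psi$ such that, for every object $C$ of $\mathcal C$, $\mu'_C$ has an inverter $\Lambda'_C\colon M'(C)\to HN(C)$ in $\mathcal C$; 2. $\mu'*\Psi$ is invertible; 3. an object $C$ of $\mathcal C$ is in the essential image of $G$ if and only if $(C,\Psi_C)$ is an inverter of $\mu'_C$; 4. for every $C$, $HN$ preserves the pseudomonicity of $\Lambda'_C$, i.e. if $\Lambda'_C$ is pseudomonic then so is $HN(\Lambda'_C)$. Then, for every object $C$ of $\mathcal C$, $M'(C)$ is in the essential image of $G$. Moreover, for every choice of objects $M(C)$ of $\mathcal B$ with $G(M(C))$ equivalent to $M'(C)$, there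 is a pseudofunctor $\mathcal C\to\mathcal B$, given by $C\mapsto M(C)$ on objects, which is left biadjoint to $G$. -/

import Mathlib

open CategoryTheory Bicategory
open scoped CategoryTheory.Pseudofunctor.StrongTrans

universe w₁ w₂ w₃ w₄ v₁ v₂ v₃ v₄ u₁ u₂ u₃ u₄

namespace BicatInverter

section Whiskering

variable {A : Type u₁} [Bicategory.{w₁, v₁} A] {B : Type u₂} [Bicategory.{w₂, v₂} B]
  {C : Type u₃} [Bicategory.{w₃, v₃} C] {D : Type u₄} [Bicategory.{w₄, v₄} D]

/-- Pre-whiskering `Ψ_P` of a pseudonatural transformation `Ψ : G₁ ⇒ G₂` by a pseudofunctor `P`: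
its component at `X` is `Ψ_{P X}`, its component at `f` is `Ψ_{P f}`. -/
def preWhisker (P : A ⥤ᵖ B) {G₁ G₂ : B ⥤ᵖ C} (Ψ : G₁ ⟶ G₂) : P.comp G₁ ⟶ P.comp G₂ where
  app X := Ψ.app (P.obj X)
  naturality f := Ψ.naturality (P.map f)
  naturality_naturality η := Ψ.naturality_naturality (P.map₂ η)
  naturality_id X := by
    have h1 := Ψ.naturality_naturality (P.mapId X).hom
    have h2 := Ψ.naturality_id (P.obj X)
    change (Ψ.naturality (P.map (𝟙 X))).hom ≫
      Ψ.app (P.obj X) ◁ (G₂.map₂ (P.mapId X).hom ≫ (G₂.mapId (P.obj X)).hom) =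
      (G₁.map₂ (P.mapId X).hom ≫ (G₁.mapId (P.obj X)).hom) ▷ Ψ.app (P.obj X) ≫
        (λ_ (Ψ.app (P.obj X))).hom ≫ (ρ_ (Ψ.app (P.obj X))).inv
    rw [Bicategory.whiskerLeft_comp, ← reassoc_of% h1, h2, Bicategory.comp_whiskerRight,
      Category.assoc]
  naturality_comp {a b c} f g := by
    have h1 := Ψ.naturality_naturality (P.mapComp f g).hom
    have h2 := Ψ.naturality_comp (P.map f) (P.map g)
    change (Ψ.naturality (P.map (f ≫ g))).hom ≫ Ψ.app (P.obj a) ◁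
        (G₂.map₂ (P.mapComp f g).hom ≫ (G₂.mapComp (P.map f) (P.map g)).hom) =
      (G₁.map₂ (P.mapComp f g).hom ≫ (G₁.mapComp (P.map f) (P.map g)).hom) ▷ Ψ.app (P.obj c) ≫
        (α_ (G₁.map (P.map f)) (G₁.map (P.map g)) (Ψ.app (P.obj c))).hom ≫
        G₁.map (P.map f) ◁ (Ψ.naturality (P.map g)).hom ≫
          (α_ (G₁.map (P.map f)) (Ψ.app (P.obj b)) (G₂.map (P.map g))).inv ≫
            (Ψ.naturality (P.map f)).hom ▷ G₂.map (P.map g) ≫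
              (α_ (Ψ.app (P.obj a)) (G₂.map (P.map f)) (G₂.map (P.map g))).hom
    rw [Bicategory.whiskerLeft_comp, ← reassoc_of% h1, h2, Bicategory.comp_whiskerRight,
      Category.assoc]

/-- Post-whiskering `G Φ` of a pseudonatural transformation `Φ : F₁ ⇒ F₂` by a pseudofunctor `G`:
its component at `X` is `G (Φ_X)`, its component at `f` is `G (Φ_f)` conjugated by the
composition constraints of `G`. -/
def postWhisker {F₁ F₂ : A ⥤ᵖ B} (Φ : F₁ ⟶ F₂) (G : B ⥤ᵖ C) : F₁.comp G ⟶ F₂.comp G where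
  app X := G.map (Φ.app X)
  naturality {X Y} f := (G.mapComp (F₁.map f) (Φ.app Y)).symm ≪≫ G.map₂Iso (Φ.naturality f) ≪≫
    G.mapComp (Φ.app X) (F₂.map f)
  naturality_naturality {a b f g} η := by
    have h := congrArg (fun t => G.map₂ t) (Φ.naturality_naturality η)
    simp only [PrelaxFunctor.map₂_comp, Pseudofunctor.map₂_whisker_left,
      Pseudofunctor.map₂_whisker_right, Category.assoc] at h
    change G.map₂ (F₁.map₂ η) ▷ G.map (Φ.app b) ≫ (G.mapComp (F₁.map g) (Φ.app b)).inv ≫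
        G.map₂ (Φ.naturality g).hom ≫ (G.mapComp (Φ.app a) (F₂.map g)).hom =
      ((G.mapComp (F₁.map f) (Φ.app b)).inv ≫
        G.map₂ (Φ.naturality f).hom ≫ (G.mapComp (Φ.app a) (F₂.map f)).hom) ≫
        G.map (Φ.app a) ◁ G.map₂ (F₂.map₂ η)
    rw [← cancel_epi (G.mapComp (F₁.map f) (Φ.app b)).hom, reassoc_of% h]
    simp
  naturality_id a := by
    have h := congrArg (fun t => G.map₂ t) (Φ.naturality_id a)
    simp only [PrelaxFunctor.map₂_comp, Pseudofunctor.map₂_whisker_left,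
      Pseudofunctor.map₂_whisker_right, Category.assoc] at h
    change ((G.mapComp (F₁.map (𝟙 a)) (Φ.app a)).inv ≫
        G.map₂ (Φ.naturality (𝟙 a)).hom ≫ (G.mapComp (Φ.app a) (F₂.map (𝟙 a))).hom) ≫
        G.map (Φ.app a) ◁ (G.map₂ (F₂.mapId a).hom ≫ (G.mapId (F₂.obj a)).hom) =
      (G.map₂ (F₁.mapId a).hom ≫ (G.mapId (F₁.obj a)).hom) ▷ G.map (Φ.app a) ≫
        (λ_ (G.map (Φ.app a))).hom ≫ (ρ_ (G.map (Φ.app a))).inv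
    rw [← cancel_epi (G.mapComp (F₁.map (𝟙 a)) (Φ.app a)).hom]
    have h' := h =≫ (G.mapComp (Φ.app a) (𝟙 _)).hom
    simp only [Category.assoc, Iso.inv_hom_id, Category.comp_id] at h'
    simp only [Bicategory.whiskerLeft_comp, Category.assoc, Iso.hom_inv_id_assoc]
    rw [reassoc_of% h']
    have h3 := G.map₂_left_unitor (Φ.app a)
    have h4 := congrArg Iso.inv (G.mapComp_id_right (Φ.app a))
    have h5 : G.map₂ (ρ_ (Φ.app a)).inv ≫ (G.mapComp (Φ.app a) (𝟙 _)).hom ≫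
        G.map (Φ.app a) ◁ (G.mapId _).hom = (ρ_ (G.map (Φ.app a))).inv := by
      rw [Pseudofunctor.mapComp_id_right_hom]
      simp [-Pseudofunctor.map₂_right_unitor, ← PrelaxFunctor.map₂_comp_assoc]
    rw [h5, h3]
    simp
  naturality_comp {a b c} f g := by
    have h := congrArg (fun t => G.map₂ t) (Φ.naturality_comp f g)
    change ((G.mapComp (F₁.map (f ≫ g)) (Φ.app c)).inv ≫
        G.map₂ (Φ.naturality (f ≫ g)).hom ≫ (G.mapComp (Φ.app a) (F₂.map (f ≫ g))).hom) ≫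
        G.map (Φ.app a) ◁ (G.map₂ (F₂.mapComp f g).hom ≫ (G.mapComp (F₂.map f) (F₂.map g)).hom) =
      (G.map₂ (F₁.mapComp f g).hom ≫ (G.mapComp (F₁.map f) (F₁.map g)).hom) ▷ G.map (Φ.app c) ≫
        (α_ (G.map (F₁.map f)) (G.map (F₁.map g)) (G.map (Φ.app c))).hom ≫
        G.map (F₁.map f) ◁ ((G.mapComp (F₁.map g) (Φ.app c)).inv ≫
          G.map₂ (Φ.naturality g).hom ≫ (G.mapComp (Φ.app b) (F₂.map g)).hom) ≫
        (α_ (G.map (F₁.map f)) (G.map (Φ.app b)) (G.map (F₂.map g))).inv ≫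
        ((G.mapComp (F₁.map f) (Φ.app b)).inv ≫
          G.map₂ (Φ.naturality f).hom ≫ (G.mapComp (Φ.app a) (F₂.map f)).hom) ▷ G.map (F₂.map g) ≫
        (α_ (G.map (Φ.app a)) (G.map (F₂.map f)) (G.map (F₂.map g))).hom
    have h' := h =≫ (G.mapComp (Φ.app a) _).hom ≫ G.map (Φ.app a) ◁ (G.mapComp _ _).hom
    simp only [PrelaxFunctor.map₂_comp, Pseudofunctor.map₂_whisker_left,
      Pseudofunctor.map₂_whisker_right, Category.assoc, Iso.inv_hom_id_assoc,
      Pseudofunctor.map₂_associator] at h'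
    rw [← cancel_epi (G.mapComp (F₁.map (f ≫ g)) (Φ.app c)).hom]
    simp only [Bicategory.whiskerLeft_comp, Category.assoc, Iso.hom_inv_id_assoc]
    rw [h']
    have key : (G.mapComp (F₁.map f) (Φ.app b ≫ F₂.map g)).inv ≫
        G.map₂ (α_ (F₁.map f) (Φ.app b) (F₂.map g)).inv ≫
        (G.mapComp (F₁.map f ≫ Φ.app b) (F₂.map g)).hom =
        G.map (F₁.map f) ◁ (G.mapComp (Φ.app b) (F₂.map g)).hom ≫
        (α_ (G.map (F₁.map f)) (G.map (Φ.app b)) (G.map (F₂.map g))).inv ≫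
        (G.mapComp (F₁.map f) (Φ.app b)).inv ▷ G.map (F₂.map g) := by
      rw [Iso.inv_comp_eq, Pseudofunctor.mapComp_assoc_right_hom_assoc]
      simp
    simp [reassoc_of% key]

theorem id_comp_mapId (P : A ⥤ᵖ B) (X : A) :
    ((P.comp (Pseudofunctor.id B)).mapId X).hom = (P.mapId X).hom :=
  Category.comp_id (P.mapId X).hom

theorem id_comp_mapComp (P : A ⥤ᵖ B) {X Y Z : A} (f : X ⟶ Y) (g : Y ⟶ Z) :
    ((P.comp (Pseudofunctor.id B)).mapComp f g).hom = (P.mapComp f g).hom :=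
  Category.comp_id (P.mapComp f g).hom

theorem comp_id_mapId (P : A ⥤ᵖ B) (X : A) :
    (((Pseudofunctor.id A).comp P).mapId X).hom = (P.mapId X).hom := by
  change P.map₂ (𝟙 (𝟙 X)) ≫ (P.mapId X).hom = _
  simp

theorem comp_id_mapComp (P : A ⥤ᵖ B) {X Y Z : A} (f : X ⟶ Y) (g : Y ⟶ Z) :
    (((Pseudofunctor.id A).comp P).mapComp f g).hom = (P.mapComp f g).hom := by
  change P.map₂ (𝟙 (f ≫ g)) ≫ (P.mapComp f g).hom = _
  simp

/-- Pre-whiskering `Ψ_P : P ⇒ T P` of `Ψ : ID ⇒ T` by `P`. Since `ID P` and `P` act in the same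
way, no unit constraint is inserted: the component at `X` is `Ψ_{P X}`. -/
def preWhiskerUnit (P : A ⥤ᵖ B) {T : B ⥤ᵖ B} (Ψ : Pseudofunctor.id B ⟶ T) : P ⟶ P.comp T where
  app X := Ψ.app (P.obj X)
  naturality f := Ψ.naturality (P.map f)
  naturality_naturality η := (preWhisker P Ψ).naturality_naturality η
  naturality_id X := by
    have h := (preWhisker P Ψ).naturality_id X
    rw [id_comp_mapId] at h
    exact h
  naturality_comp f g := by
    have h := (preWhisker P Ψ).naturality_comp f g
    rw [id_comp_mapComp] at h
    exact h

/-- Pre-whiskering `E_P : T P ⇒ P` of `E : T ⇒ ID` by `P`; the component at `X` is `E_{P X}`. -/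
def preWhiskerCounit (P : A ⥤ᵖ B) {T : B ⥤ᵖ B} (E : T ⟶ Pseudofunctor.id B) : P.comp T ⟶ P where
  app X := E.app (P.obj X)
  naturality f := E.naturality (P.map f)
  naturality_naturality η := (preWhisker P E).naturality_naturality η
  naturality_id X := by
    have h := (preWhisker P E).naturality_id X
    rw [id_comp_mapId] at h
    exact h
  naturality_comp f g := by
    have h := (preWhisker P E).naturality_comp f g
    rw [id_comp_mapComp] at h
    exact h

/-- Post-whiskering `P Ψ : P ⇒ P T` of `Ψ : ID ⇒ T` by `P`; the component at `X` is `P (Ψ_X)`. -/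
def postWhiskerUnit {T : A ⥤ᵖ A} (Ψ : Pseudofunctor.id A ⟶ T) (P : A ⥤ᵖ B) : P ⟶ T.comp P where
  app X := P.map (Ψ.app X)
  naturality f := (postWhisker Ψ P).naturality f
  naturality_naturality η := (postWhisker Ψ P).naturality_naturality η
  naturality_id X := by
    have h := (postWhisker Ψ P).naturality_id X
    rw [comp_id_mapId] at h
    exact h
  naturality_comp f g := by
    have h := (postWhisker Ψ P).naturality_comp f g
    rw [comp_id_mapComp] at h
    exact h

/-- Post-whiskering `P E : P T ⇒ P` of `E : T ⇒ ID` by `P`; the component at `X` is `P (E_X)`. -/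
def postWhiskerCounit {T : A ⥤ᵖ A} (E : T ⟶ Pseudofunctor.id A) (P : A ⥤ᵖ B) : T.comp P ⟶ P where
  app X := P.map (E.app X)
  naturality f := (postWhisker E P).naturality f
  naturality_naturality η := (postWhisker E P).naturality_naturality η
  naturality_id X := by
    have h := (postWhisker E P).naturality_id X
    rw [comp_id_mapId] at h
    exact h
  naturality_comp f g := by
    have h := (postWhisker E P).naturality_comp f g
    rw [comp_id_mapComp] at h
    exact h

theorem comp_assoc_mapId (F₁ : A ⥤ᵖ B) (F₂ : B ⥤ᵖ C) (F₃ : C ⥤ᵖ D) (X : A) :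
    ((F₁.comp (F₂.comp F₃)).mapId X).hom = (((F₁.comp F₂).comp F₃).mapId X).hom := by
  change F₃.map₂ (F₂.map₂ (F₁.mapId X).hom) ≫
      F₃.map₂ (F₂.mapId (F₁.obj X)).hom ≫ (F₃.mapId (F₂.obj (F₁.obj X))).hom =
    F₃.map₂ (F₂.map₂ (F₁.mapId X).hom ≫ (F₂.mapId (F₁.obj X)).hom) ≫
      (F₃.mapId (F₂.obj (F₁.obj X))).hom
  simp

theorem comp_assoc_mapComp (F₁ : A ⥤ᵖ B) (F₂ : B ⥤ᵖ C) (F₃ : C ⥤ᵖ D) {X Y Z : A}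
    (f : X ⟶ Y) (g : Y ⟶ Z) :
    ((F₁.comp (F₂.comp F₃)).mapComp f g).hom = (((F₁.comp F₂).comp F₃).mapComp f g).hom := by
  change F₃.map₂ (F₂.map₂ (F₁.mapComp f g).hom) ≫
      F₃.map₂ (F₂.mapComp (F₁.map f) (F₁.map g)).hom ≫
        (F₃.mapComp (F₂.map (F₁.map f)) (F₂.map (F₁.map g))).hom =
    F₃.map₂ (F₂.map₂ (F₁.mapComp f g).hom ≫ (F₂.mapComp (F₁.map f) (F₁.map g)).hom) ≫
      (F₃.mapComp (F₂.map (F₁.map f)) (F₂.map (F₁.map g))).hom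
  simp

/-- The associator `F₃ (F₂ F₁) ⇒ (F₃ F₂) F₁` of the composition of pseudofunctors; all of its
components are identities. -/
def compAssoc (F₁ : A ⥤ᵖ B) (F₂ : B ⥤ᵖ C) (F₃ : C ⥤ᵖ D) :
    (F₁.comp F₂).comp F₃ ⟶ F₁.comp (F₂.comp F₃) where
  app X := 𝟙 (F₃.obj (F₂.obj (F₁.obj X)))
  naturality f := ρ_ (F₃.map (F₂.map (F₁.map f))) ≪≫ (λ_ (F₃.map (F₂.map (F₁.map f)))).symm
  naturality_naturality η :=
    (𝟙 ((F₁.comp F₂).comp F₃) : (F₁.comp F₂).comp F₃ ⟶ _).naturality_naturality η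
  naturality_id X := by
    have h := (𝟙 ((F₁.comp F₂).comp F₃) : (F₁.comp F₂).comp F₃ ⟶ _).naturality_id X
    rw [comp_assoc_mapId]
    exact h
  naturality_comp f g := by
    have h := (𝟙 ((F₁.comp F₂).comp F₃) : (F₁.comp F₂).comp F₃ ⟶ _).naturality_comp f g
    rw [comp_assoc_mapComp]
    exact h

/-- The associator `(F₃ F₂) F₁ ⇒ F₃ (F₂ F₁)` of the composition of pseudofunctors; all of its
components are identities. -/
def compAssocInv (F₁ : A ⥤ᵖ B) (F₂ : B ⥤ᵖ C) (F₃ : C ⥤ᵖ D) :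
    F₁.comp (F₂.comp F₃) ⟶ (F₁.comp F₂).comp F₃ where
  app X := 𝟙 (F₃.obj (F₂.obj (F₁.obj X)))
  naturality f := ρ_ (F₃.map (F₂.map (F₁.map f))) ≪≫ (λ_ (F₃.map (F₂.map (F₁.map f)))).symm
  naturality_naturality η :=
    (𝟙 ((F₁.comp F₂).comp F₃) : (F₁.comp F₂).comp F₃ ⟶ _).naturality_naturality η
  naturality_id X := by
    have h := (𝟙 ((F₁.comp F₂).comp F₃) : (F₁.comp F₂).comp F₃ ⟶ _).naturality_id X
    rw [comp_assoc_mapId]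
    exact h
  naturality_comp f g := by
    have h := (𝟙 ((F₁.comp F₂).comp F₃) : (F₁.comp F₂).comp F₃ ⟶ _).naturality_comp f g
    rw [comp_assoc_mapComp]
    exact h

end Whiskering

section Biadjunction

variable {A : Type u₁} [Bicategory.{w₁, v₁} A] {B : Type u₂} [Bicategory.{w₂, v₂} B]

/-- A biadjunction `L ⊣ R` between pseudofunctors `L : A → B` and `R : B → A`: a unit
`ID ⇒ R L`, a counit `L R ⇒ ID`, and two invertible modifications filling the triangles. -/
structure Biadjunction (L : A ⥤ᵖ B) (R : B ⥤ᵖ A) where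
  /-- The unit `ID ⇒ R L`. -/
  unit : Pseudofunctor.id A ⟶ L.comp R
  /-- The counit `L R ⇒ ID`. -/
  counit : R.comp L ⟶ Pseudofunctor.id B
  /-- The invertible modification from `L ⇒ L (R L) ⇒ (L R) L ⇒ L` to the identity of `L`. -/
  leftTriangle :
    postWhiskerUnit unit L ≫ compAssoc L R L ≫ preWhiskerCounit L counit ≅ 𝟙 L
  /-- The invertible modification from `R ⇒ (R L) R ⇒ R (L R) ⇒ R` to the identity of `R`. -/
  rightTriangle :
    preWhiskerUnit R unit ≫ compAssocInv R L R ≫ postWhiskerCounit counit R ≅ 𝟙 R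

/-- A pseudofunctor is fully faithful if its local functors `Hom(X, Y) → Hom(G X, G Y)` are
equivalences of categories. -/
def IsFullyFaithful (G : A ⥤ᵖ B) : Prop :=
  ∀ X Y : A, (G.mapFunctor X Y).IsEquivalence

/-- An object is in the essential image of `G` if it is equivalent to some `G X`. -/
def InEssImage (G : A ⥤ᵖ B) (Y : B) : Prop :=
  ∃ X : A, Nonempty (G.obj X ≌ Y)

end Biadjunction

section Inverters

variable {C : Type u₁} [Bicategory.{w₁, v₁} C]

/-- The full subcategory `InvCone(W; φ)` of `Hom(W, X₁)` is given by the `f : W ⟶ X₁` such that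
`φ * f` is invertible. -/
def invCone (W : C) {X₁ X₂ : C} {f₁ f₂ : X₁ ⟶ X₂} (φ : f₁ ⟶ f₂) : ObjectProperty (W ⟶ X₁) :=
  fun f => IsIso (f ◁ φ)

/-- If `φ * f₀` is invertible, so is `φ * (f₀ ∘ g)`. -/
theorem invCone_comp {W X₀ X₁ X₂ : C} {f₁ f₂ : X₁ ⟶ X₂} (φ : f₁ ⟶ f₂) {f₀ : X₀ ⟶ X₁}
    (h : invCone X₀ φ f₀) (g : W ⟶ X₀) : invCone W φ (g ≫ f₀) := by
  have : IsIso (f₀ ◁ φ) := h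
  change IsIso ((g ≫ f₀) ◁ φ)
  rw [Bicategory.comp_whiskerLeft]
  infer_instance

/-- The functor `Hom(W, X₀) → InvCone(W; φ)` of composition with an inverter cone `f₀`. -/
def toInvCone (W : C) {X₀ X₁ X₂ : C} {f₁ f₂ : X₁ ⟶ X₂} (φ : f₁ ⟶ f₂) {f₀ : X₀ ⟶ X₁}
    (h : invCone X₀ φ f₀) : (W ⟶ X₀) ⥤ (invCone W φ).FullSubcategory :=
  (invCone W φ).lift (postcomp W f₀) (invCone_comp φ h)

/-- `(X₀, f₀)` is an inverter of `φ`: it is a universal inverter cone. -/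
structure IsInverter {X₀ X₁ X₂ : C} {f₁ f₂ : X₁ ⟶ X₂} (φ : f₁ ⟶ f₂) (f₀ : X₀ ⟶ X₁) : Prop where
  /-- `φ * f₀` is invertible. -/
  cone : invCone X₀ φ f₀
  /-- Composition with `f₀` is an equivalence `Hom(W, X₀) ≃ InvCone(W; φ)`. -/
  universal : ∀ W : C, (toInvCone W φ cone).IsEquivalence

/-- A 1-morphism `f : X ⟶ Y` is pseudomonic if for every `W` the functor
`Hom(W, X) → Hom(W, Y)` of composition with `f` is pseudomonic, that is, faithful and full on
isomorphisms. -/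
structure IsPseudomonic {X Y : C} (f : X ⟶ Y) : Prop where
  /-- Composition with `f` is faithful. -/
  faithful : ∀ W : C, (postcomp W f).Faithful
  /-- Composition with `f` is full on isomorphisms. -/
  full_on_isos : ∀ (W : C) (g h : W ⟶ X) (e : g ≫ f ≅ h ≫ f),
    ∃ e' : g ≅ h, whiskerRightIso e' f = e

end Inverters

end BicatInverter

/-! Write T = HN, Ψ for its unit and μ for the modification, and call X local if Ψ_X is an inverter
of μ_X; by assumption 3 these objects form the essential image of G. Each TX is local because H ≃
GF. As Ψ_X inverts μ_X, it factors as Ψ_X ≅ Λ ∘ θ with θ : X → M'(X), and the point is that θ is a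
reflection of X into the local objects.

The key isomorphism is Tθ ∘ Λ ≅ Ψ_{M'(X)} (`nonempty_app_iso`). After composition with the
pseudomonic TΛ it becomes TΨ_X ∘ Λ ≅ Ψ_{TX} ∘ Λ, which is μ_X restricted to its inverter. For Y
local, f ↦ Tf ∘ Λ lands in the 1-morphisms inverting μ_Y, hence lifts through Ψ_Y; this is a
quasi-inverse to composition with θ (`Pointing.isEquivalence_precomp`). That M'(X) is itself local
is `Pointing.isLocal_of_isInverter`.

Since G is fully faithful, θ followed by M'(X) ≃ G(M(X)) is a biuniversal arrow to G, and a choice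
of biuniversal arrows determines a left biadjoint. Its coherence laws all come from one principle: a
2-morphism out of M(X) is determined by the 2-morphism of C it lies over (`IsBiuniversal.ext`). -/

namespace BicatInverter

/-! ### Squares over G and biuniversal arrows -/

section Squares

variable {B : Type u₁} [Bicategory.{w₁, v₁} B] {C : Type u₂} [Bicategory.{w₂, v₂} C]
  (G : B ⥤ᵖ C)

/-- A morphism `(f, h)` from `p : X ⟶ G a` to `q : Y ⟶ G b` in the pseudo-comma bicategory
`C ↓ G`: the square `f ≫ q ≅ p ≫ G h`. -/
abbrev Sq {X Y : C} {a b : B} (p : X ⟶ G.obj a) (q : Y ⟶ G.obj b) (f : X ⟶ Y) (h : a ⟶ b) :=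
  f ≫ q ≅ p ≫ G.map h

/-- The identity square. -/
def Sq.id {X : C} {a : B} (p : X ⟶ G.obj a) : Sq G p p (𝟙 X) (𝟙 a) :=
  λ_ p ≪≫ (ρ_ p).symm ≪≫ whiskerLeftIso p (G.mapId a).symm

variable {G} {X Y Z W : C} {a b c d : B} {p : X ⟶ G.obj a} {q : Y ⟶ G.obj b} {r : Z ⟶ G.obj c}
  {s : W ⟶ G.obj d}

/-- Pasting of squares. -/
def Sq.comp {f : X ⟶ Y} {g : Y ⟶ Z} {h : a ⟶ b} {k : b ⟶ c} (ν : Sq G p q f h)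
    (ν' : Sq G q r g k) : Sq G p r (f ≫ g) (h ≫ k) :=
  α_ f g r ≪≫ whiskerLeftIso f ν' ≪≫ (α_ f q (G.map k)).symm ≪≫ whiskerRightIso ν (G.map k) ≪≫
    α_ p (G.map h) (G.map k) ≪≫ whiskerLeftIso p (G.mapComp h k).symm

/-- The pair `(α, β)` is a 2-morphism of squares `ν ⟶ ν'`. -/
def Over {f f' : X ⟶ Y} {h h' : a ⟶ b} (ν : Sq G p q f h) (ν' : Sq G p q f' h') (α : f ⟶ f')
    (β : h ⟶ h') : Prop :=
  ν.hom ≫ p ◁ G.map₂ β = α ▷ q ≫ ν'.hom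

theorem Over.id {f : X ⟶ Y} {h : a ⟶ b} (ν : Sq G p q f h) : Over ν ν (𝟙 f) (𝟙 h) := by
  simp [Over]

theorem Over.comp {f f' f'' : X ⟶ Y} {h h' h'' : a ⟶ b} {ν : Sq G p q f h} {ν' : Sq G p q f' h'}
    {ν'' : Sq G p q f'' h''} {α : f ⟶ f'} {α' : f' ⟶ f''} {β : h ⟶ h'} {β' : h' ⟶ h''}
    (o : Over ν ν' α β) (o' : Over ν' ν'' α' β') : Over ν ν'' (α ≫ α') (β ≫ β') := by
  unfold Over at *
  rw [PrelaxFunctor.map₂_comp, Bicategory.whiskerLeft_comp, reassoc_of% o, o',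
    Bicategory.comp_whiskerRight, Category.assoc]

theorem Over.inv {f f' : X ⟶ Y} {h h' : a ⟶ b} {ν : Sq G p q f h} {ν' : Sq G p q f' h'}
    {α : f ≅ f'} {β : h ≅ h'} (o : Over ν ν' α.hom β.hom) : Over ν' ν α.inv β.inv := by
  unfold Over at *
  rw [← cancel_epi (α.hom ▷ q), ← reassoc_of% o]
  simp [← Bicategory.whiskerLeft_comp, ← PrelaxFunctor.map₂_comp]

theorem Over.whiskerLeft {f : X ⟶ Y} {h : a ⟶ b} (ν : Sq G p q f h) {g g' : Y ⟶ Z} {k k' : b ⟶ c}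
    {ν₁ : Sq G q r g k} {ν₁' : Sq G q r g' k'} {α : g ⟶ g'} {β : k ⟶ k'} (o : Over ν₁ ν₁' α β) :
    Over (ν.comp ν₁) (ν.comp ν₁') (f ◁ α) (h ◁ β) := by
  unfold Over at *
  have o' := congrArg (fun t => f ◁ t) o
  simp only [Bicategory.whiskerLeft_comp] at o'
  simp only [Sq.comp, Iso.trans_hom, Iso.symm_hom, whiskerLeftIso_hom, whiskerRightIso_hom,
    Category.assoc, Pseudofunctor.map₂_whisker_left, Bicategory.whiskerLeft_comp,
    whiskerLeft_inv_hom_assoc, associator_naturality_middle_assoc, ← reassoc_of% o']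
  rw [associator_inv_naturality_right_assoc, whisker_exchange_assoc,
    associator_naturality_right_assoc]

theorem Over.whiskerRight {f f' : X ⟶ Y} {h h' : a ⟶ b} {ν : Sq G p q f h} {ν' : Sq G p q f' h'}
    {α : f ⟶ f'} {β : h ⟶ h'} (o : Over ν ν' α β) {g : Y ⟶ Z} {k : b ⟶ c}
    (ν₁ : Sq G q r g k) :
    Over (ν.comp ν₁) (ν'.comp ν₁) (α ▷ g) (β ▷ k) := by
  unfold Over at *
  have o' := congrArg (fun t => t ▷ G.map k) o
  simp only [Bicategory.comp_whiskerRight] at o'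
  simp only [Sq.comp, Iso.trans_hom, Iso.symm_hom, whiskerLeftIso_hom, whiskerRightIso_hom,
    Category.assoc, Pseudofunctor.map₂_whisker_right, Bicategory.whiskerLeft_comp,
    whiskerLeft_inv_hom_assoc, associator_naturality_left_assoc]
  rw [← whisker_exchange_assoc, associator_inv_naturality_left_assoc, ← reassoc_of% o',
    associator_naturality_middle_assoc]

theorem Over.associator {f : X ⟶ Y} {g : Y ⟶ Z} {e : Z ⟶ W} {h : a ⟶ b} {k : b ⟶ c} {l : c ⟶ d}
    (ν₁ : Sq G p q f h) (ν₂ : Sq G q r g k) (ν₃ : Sq G r s e l) :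
    Over ((ν₁.comp ν₂).comp ν₃) (ν₁.comp (ν₂.comp ν₃)) (α_ f g e).hom (α_ h k l).hom := by
  simp only [Over, Sq.comp, Iso.trans_hom, Iso.symm_hom, whiskerLeftIso_hom, whiskerRightIso_hom,
    Pseudofunctor.map₂_associator]
  simp only [Bicategory.whiskerLeft_comp, Category.assoc, Bicategory.comp_whiskerRight,
    associator_inv_naturality_right_assoc, associator_naturality_right_assoc, whisker_exchange_assoc]
  simp

theorem Over.leftUnitor {f : X ⟶ Y} {h : a ⟶ b} (ν : Sq G p q f h) :
    Over ((Sq.id G p).comp ν) ν (λ_ f).hom (λ_ h).hom := by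
  simp [Over, Sq.comp, Sq.id]

theorem Over.rightUnitor {f : X ⟶ Y} {h : a ⟶ b} (ν : Sq G p q f h) :
    Over (ν.comp (Sq.id G q)) ν (ρ_ f).hom (ρ_ h).hom := by
  simp [Over, Sq.comp, Sq.id]
  rw [associator_inv_naturality_right_assoc, whisker_exchange_assoc,
    associator_naturality_right_assoc]
  simp

/-- `p : X ⟶ G a` is a biuniversal arrow from `X` to `G`. -/
def IsBiuniversal (p : X ⟶ G.obj a) : Prop :=
  ∀ b : B, (G.mapFunctor a b ⋙ precomp (G.obj b) p).IsEquivalence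

theorem IsBiuniversal.existsSq (hp : IsBiuniversal p) (f : X ⟶ Y) (q : Y ⟶ G.obj b) :
    ∃ h : a ⟶ b, Nonempty (Sq G p q f h) := by
  have := hp b
  exact ⟨_, ⟨((G.mapFunctor a b ⋙ precomp (G.obj b) p).objObjPreimageIso (f ≫ q)).symm⟩⟩

/-- The 1-morphism induced by a biuniversal arrow. -/
noncomputable def IsBiuniversal.map (hp : IsBiuniversal p) (f : X ⟶ Y) (q : Y ⟶ G.obj b) : a ⟶ b :=
  (hp.existsSq f q).choose

/-- The square of the 1-morphism induced by a biuniversal arrow. -/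
noncomputable def IsBiuniversal.sq (hp : IsBiuniversal p) (f : X ⟶ Y) (q : Y ⟶ G.obj b) :
    Sq G p q f (hp.map f q) :=
  (hp.existsSq f q).choose_spec.some

/-- Faithfulness of Hom(a, b) → Hom(X, G b). Keeping `w` as a separate hypothesis lets the two sides
of an axiom in B be built from `Over` steps, leaving only an equation in C. -/
theorem IsBiuniversal.ext (hp : IsBiuniversal p) {f f' : X ⟶ Y} {h h' : a ⟶ b}
    {ν : Sq G p q f h} {ν' : Sq G p q f' h'} {α α' : f ⟶ f'} {β β' : h ⟶ h'}
    (o : Over ν ν' α β) (o' : Over ν ν' α' β') (w : α = α') : β = β' := by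
  subst w
  have := hp b
  apply (G.mapFunctor a b ⋙ precomp (G.obj b) p).map_injective
  change p ◁ G.map₂ β = p ◁ G.map₂ β'
  rw [← cancel_epi ν.hom]
  exact o.trans o'.symm

/-- Fullness of the same functor, applied to the conjugate of `α ▷ q` by the two squares. -/
theorem IsBiuniversal.existsLift (hp : IsBiuniversal p) {f f' : X ⟶ Y} {h h' : a ⟶ b}
    (ν : Sq G p q f h) (ν' : Sq G p q f' h') (α : f ⟶ f') : ∃ β, Over ν ν' α β := by
  have := hp b
  obtain ⟨β, hβ⟩ := (G.mapFunctor a b ⋙ precomp (G.obj b) p).map_surjective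
    (X := h) (Y := h') (ν.inv ≫ α ▷ q ≫ ν'.hom)
  exact ⟨β, by rw [Over, ← Iso.eq_inv_comp]; exact hβ⟩

/-- The 2-morphism induced by a biuniversal arrow. -/
noncomputable def IsBiuniversal.lift (hp : IsBiuniversal p) {f f' : X ⟶ Y} {h h' : a ⟶ b}
    (ν : Sq G p q f h) (ν' : Sq G p q f' h') (α : f ⟶ f') : h ⟶ h' :=
  (hp.existsLift ν ν' α).choose

theorem IsBiuniversal.over_lift (hp : IsBiuniversal p) {f f' : X ⟶ Y} {h h' : a ⟶ b}
    (ν : Sq G p q f h) (ν' : Sq G p q f' h') (α : f ⟶ f') : Over ν ν' α (hp.lift ν ν' α) :=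
  (hp.existsLift ν ν' α).choose_spec

/-- The invertible 2-morphism induced by a biuniversal arrow. -/
noncomputable def IsBiuniversal.liftIso (hp : IsBiuniversal p) {f f' : X ⟶ Y} {h h' : a ⟶ b}
    (ν : Sq G p q f h) (ν' : Sq G p q f' h') (α : f ≅ f') : h ≅ h' where
  hom := hp.lift ν ν' α.hom
  inv := hp.lift ν' ν α.inv
  hom_inv_id := hp.ext ((hp.over_lift _ _ _).comp (hp.over_lift _ _ _)) (Over.id ν) (by simp)
  inv_hom_id := hp.ext ((hp.over_lift _ _ _).comp (hp.over_lift _ _ _)) (Over.id ν') (by simp)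

theorem IsBiuniversal.over_liftIso (hp : IsBiuniversal p) {f f' : X ⟶ Y} {h h' : a ⟶ b}
    (ν : Sq G p q f h) (ν' : Sq G p q f' h') (α : f ≅ f') :
    Over ν ν' α.hom (hp.liftIso ν ν' α).hom :=
  hp.over_lift ν ν' α.hom

variable (G) in
/-- The square of `h` between identities. -/
def Sq.ofHom (h : a ⟶ b) : Sq G (𝟙 (G.obj a)) (𝟙 (G.obj b)) (G.map h) h :=
  ρ_ _ ≪≫ (λ_ _).symm

theorem Over.ofHom {h k : a ⟶ b} (β : h ⟶ k) :
    Over (Sq.ofHom G h) (Sq.ofHom G k) (G.map₂ β) β := by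
  simp [Over, Sq.ofHom]

theorem Over.ofHom_id (a : B) :
    Over (Sq.ofHom G (𝟙 a)) (Sq.id G (𝟙 (G.obj a))) (G.mapId a).hom (𝟙 _) := by
  simp [Over, Sq.ofHom, Sq.id]

theorem Over.ofHom_comp (h : a ⟶ b) (k : b ⟶ c) :
    Over (Sq.ofHom G (h ≫ k)) ((Sq.ofHom G h).comp (Sq.ofHom G k)) (G.mapComp h k).hom (𝟙 _) := by
  simp [Over, Sq.ofHom, Sq.comp]

/-- The square of a morphism to `G a`. -/
def Sq.ofArrow (p : X ⟶ G.obj a) : Sq G p (𝟙 (G.obj a)) p (𝟙 a) :=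
  whiskerLeftIso p (G.mapId a).symm

/-- A square is also a 2-morphism between squares ending in an identity; for the unit this yields
the naturality of the left triangle. -/
theorem Over.ofArrow {f : X ⟶ Y} {h : a ⟶ b} (ν : Sq G p q f h) :
    Over (ν.comp (Sq.ofArrow q)) ((Sq.ofArrow p).comp (Sq.ofHom G h)) ν.hom
      ((ρ_ h).hom ≫ (λ_ h).inv) := by
  simp [Over, Sq.ofHom, Sq.comp, Sq.ofArrow]
  rw [associator_inv_naturality_right_assoc, whisker_exchange_assoc,
    associator_naturality_right_assoc]
  have : G.map₂ (λ_ h).inv = (λ_ (G.map h)).inv ≫ (G.mapId a).inv ▷ G.map h ≫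
      (G.mapComp (𝟙 a) h).inv := by
    rw [← cancel_mono (G.map₂ (λ_ h).hom), ← PrelaxFunctor.map₂_comp]
    simp
  simp [this]

end Squares

/-! ### The left biadjoint determined by biuniversal arrows -/

section LeftBiadjoint

variable {B : Type u₁} [Bicategory.{w₁, v₁} B] {C : Type u₂} [Bicategory.{w₂, v₂} C]
  {G : B ⥤ᵖ C} {M : C → B} {η : ∀ X : C, X ⟶ G.obj (M X)} (hη : ∀ X, IsBiuniversal (η X))

/-- The pseudofunctor given by a choice of biuniversal arrows. -/
noncomputable def leftBiadjoint : C ⥤ᵖ B where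
  obj := M
  map {X Y} f := (hη X).map f (η Y)
  map₂ {X Y} f g α := (hη X).lift ((hη X).sq f (η Y)) ((hη X).sq g (η Y)) α
  -- In each axiom the chain of `Over`s retraces the two sides factor by factor. The constraints lie
  -- over identities, so only coherence in C remains.
  map₂_id {X Y} f := (hη X).ext ((hη X).over_lift _ _ _) (Over.id _) rfl
  map₂_comp {X Y} f g h α β := (hη X).ext ((hη X).over_lift _ _ _)
    (((hη X).over_lift _ _ _).comp ((hη X).over_lift _ _ _)) rfl
  mapId X := (hη X).liftIso ((hη X).sq (𝟙 X) (η X)) (Sq.id G (η X)) (Iso.refl _)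
  mapComp {X Y Z} f g := (hη X).liftIso ((hη X).sq (f ≫ g) (η Z))
    (((hη X).sq f (η Y)).comp ((hη Y).sq g (η Z))) (Iso.refl _)
  map₂_whisker_left {X Y Z} f g h α := (hη X).ext ((hη X).over_lift _ _ _)
    (((hη X).over_liftIso _ _ _).comp ((((hη Y).over_lift _ _ _).whiskerLeft _).comp
      ((hη X).over_liftIso _ _ _).inv)) (by simp)
  map₂_whisker_right {X Y Z} f g α h := (hη X).ext ((hη X).over_lift _ _ _)
    (((hη X).over_liftIso _ _ _).comp ((((hη X).over_lift _ _ _).whiskerRight _).comp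
      ((hη X).over_liftIso _ _ _).inv)) (by simp)
  map₂_associator {X Y Z W} f g h := (hη X).ext ((hη X).over_lift _ _ _)
    (((hη X).over_liftIso _ _ _).comp ((((hη X).over_liftIso _ _ _).whiskerRight _).comp
      ((Over.associator _ _ _).comp ((((hη Y).over_liftIso _ _ _).inv.whiskerLeft _).comp
        ((hη X).over_liftIso _ _ _).inv)))) (by simp)
  map₂_left_unitor {X Y} f := (hη X).ext ((hη X).over_lift _ _ _)
    (((hη X).over_liftIso _ _ _).comp ((((hη X).over_liftIso _ _ _).whiskerRight _).comp
      (Over.leftUnitor _))) (by simp)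
  map₂_right_unitor {X Y} f := (hη X).ext ((hη X).over_lift _ _ _)
    (((hη X).over_liftIso _ _ _).comp ((((hη Y).over_liftIso _ _ _).whiskerLeft _).comp
      (Over.rightUnitor _))) (by simp)

/-- The unit of the biadjunction given by a choice of biuniversal arrows. -/
noncomputable def leftBiadjointUnit : Pseudofunctor.id C ⟶ (leftBiadjoint hη).comp G where
  app := η
  naturality {X Y} f := (hη X).sq f (η Y)
  naturality_naturality {X Y} f g α :=
    ((hη X).over_lift ((hη X).sq f (η Y)) ((hη X).sq g (η Y)) α).symm
  naturality_id X := by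
    have o := (hη X).over_liftIso ((hη X).sq (𝟙 X) (η X)) (Sq.id G (η X)) (Iso.refl _)
    -- Once the constraint of G is split off, the `Over` equation of `mapId` is the unit axiom.
    change ((hη X).sq (𝟙 X) (η X)).hom ≫ η X ◁ (G.map₂ ((hη X).liftIso _ _ _).hom ≫
      (G.mapId _).hom) = 𝟙 _ ▷ η X ≫ _
    rw [Bicategory.whiskerLeft_comp, reassoc_of% o]
    simp only [Sq.id, Iso.refl_hom, Iso.trans_hom, Iso.symm_hom, whiskerLeftIso_hom,
      Category.assoc, whiskerLeft_inv_hom, Category.comp_id]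
    rfl
  naturality_comp {X Y Z} f g := by
    have o := (hη X).over_liftIso ((hη X).sq (f ≫ g) (η Z))
      (((hη X).sq f (η Y)).comp ((hη Y).sq g (η Z))) (Iso.refl _)
    change ((hη X).sq (f ≫ g) (η Z)).hom ≫ η X ◁ (G.map₂ ((hη X).liftIso _ _ _).hom ≫
      (G.mapComp _ _).hom) = 𝟙 _ ▷ η Z ≫ _
    rw [Bicategory.whiskerLeft_comp, reassoc_of% o]
    simp only [Sq.comp, Iso.refl_hom, Iso.trans_hom, Iso.symm_hom, whiskerLeftIso_hom,
      whiskerRightIso_hom, Category.assoc, whiskerLeft_inv_hom, Category.comp_id]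
    rfl

/-- The component of the counit of the biadjunction given by a choice of biuniversal arrows. -/
noncomputable def counitApp (b : B) : M (G.obj b) ⟶ b :=
  (hη (G.obj b)).map (𝟙 _) (𝟙 _)

/-- The square of `counitApp`. -/
noncomputable def counitSq (b : B) :
    Sq G (η (G.obj b)) (𝟙 (G.obj b)) (𝟙 (G.obj b)) (counitApp hη b) :=
  (hη (G.obj b)).sq (𝟙 _) (𝟙 _)

/-- The naturality constraint of the counit of the biadjunction given by a choice of biuniversal
arrows. -/
noncomputable def counitNaturality {a b : B} (h : a ⟶ b) :
    (leftBiadjoint hη).map (G.map h) ≫ counitApp hη b ≅ counitApp hη a ≫ h :=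
  (hη (G.obj a)).liftIso (((hη _).sq (G.map h) (η _)).comp (counitSq hη b))
    ((counitSq hη a).comp (Sq.ofHom G h)) (ρ_ _ ≪≫ (λ_ _).symm)

theorem over_counitNaturality {a b : B} (h : a ⟶ b) :
    Over (((hη _).sq (G.map h) (η _)).comp (counitSq hη b)) ((counitSq hη a).comp (Sq.ofHom G h))
      (ρ_ (G.map h) ≪≫ (λ_ _).symm).hom (counitNaturality hη h).hom :=
  (hη (G.obj a)).over_liftIso _ _ _

/-- The counit of the biadjunction given by a choice of biuniversal arrows. -/
noncomputable def leftBiadjointCounit : G.comp (leftBiadjoint hη) ⟶ Pseudofunctor.id B where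
  app b := counitApp hη b
  naturality {a b} h := counitNaturality hη h
  naturality_naturality {a b} h k β :=
    (hη (G.obj a)).ext
      ((((hη _).over_lift _ _ (G.map₂ β)).whiskerRight _).comp (over_counitNaturality hη k))
      ((over_counitNaturality hη h).comp ((Over.ofHom β).whiskerLeft _)) (by simp)
  naturality_id a :=
    (hη (G.obj a)).ext
      ((over_counitNaturality hη (𝟙 a)).comp ((Over.ofHom_id a).whiskerLeft _))
      (((((hη _).over_lift _ _ (G.mapId a).hom).comp
        ((hη (G.obj a)).over_liftIso _ _ _)).whiskerRight _).comp
          ((Over.leftUnitor (counitSq hη a)).comp (Over.rightUnitor (counitSq hη a)).inv))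
      (by simp)
  naturality_comp {a b c} h k :=
    (hη (G.obj a)).ext
      ((over_counitNaturality hη (h ≫ k)).comp ((Over.ofHom_comp h k).whiskerLeft _))
      (((((hη _).over_lift _ _ (G.mapComp h k).hom).comp
        ((hη (G.obj a)).over_liftIso _ _ _)).whiskerRight _).comp
          ((Over.associator _ _ _).comp (((over_counitNaturality hη k).whiskerLeft _).comp
            ((Over.inv (Over.associator _ _ _)).comp
              (((over_counitNaturality hη h).whiskerRight _).comp (Over.associator _ _ _))))))
      (by simp)

/-- The component of the left triangle modification. -/
noncomputable def leftTriangleApp (X : C) :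
    (leftBiadjoint hη).map (η X) ≫ 𝟙 (M (G.obj (M X))) ≫ counitApp hη (M X) ≅ 𝟙 (M X) :=
  (hη X).liftIso
    (((hη X).sq (η X) (η _)).comp ((Sq.id G (η (G.obj (M X)))).comp (counitSq hη (M X))))
    (Sq.ofArrow (η X)) (whiskerLeftIso (η X) (λ_ _) ≪≫ ρ_ _)

theorem over_leftTriangleApp (X : C) :
    Over (((hη X).sq (η X) (η _)).comp ((Sq.id G (η (G.obj (M X)))).comp (counitSq hη (M X))))
      (Sq.ofArrow (η X)) (whiskerLeftIso (η X) (λ_ _) ≪≫ ρ_ _).hom (leftTriangleApp hη X).hom :=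
  (hη X).over_liftIso _ _ _

/-- Both sides are 2-morphisms of B out of M(X), so it is enough that they lie over the same
2-morphism of C; the second chain follows the right-hand side factor by factor. -/
theorem leftTriangleApp_naturality {X Y : C} (f : X ⟶ Y) :
    (leftBiadjoint hη).map f ◁ (leftTriangleApp hη Y).hom ≫
      (ρ_ ((leftBiadjoint hη).map f)).hom ≫ (λ_ ((leftBiadjoint hη).map f)).inv =
    ((α_ _ _ _).inv ≫
      (((leftBiadjoint hη).mapComp f (η Y)).inv ≫
        (leftBiadjoint hη).map₂ ((hη X).sq f (η Y)).hom ≫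
        ((leftBiadjoint hη).mapComp (η X) (G.map ((leftBiadjoint hη).map f))).hom) ▷ _ ≫
      (α_ _ _ _).hom ≫
      _ ◁ ((α_ _ _ _).inv ≫ ((ρ_ _).hom ≫ (λ_ _).inv) ▷ _ ≫ (α_ _ _ _).hom ≫
        _ ◁ (counitNaturality hη ((leftBiadjoint hη).map f)).hom ≫ (α_ _ _ _).inv) ≫
      (α_ _ _ _).inv) ≫
    (leftTriangleApp hη X).hom ▷ (leftBiadjoint hη).map f :=
  (hη X).ext
    (((over_leftTriangleApp hη Y).whiskerLeft ((hη X).sq f (η Y))).comp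
      (Over.ofArrow ((hη X).sq f (η Y))))
    ((((Over.associator _ _ _).inv).comp
      (((((hη X).over_liftIso _ _ _).inv.comp (((hη X).over_lift _ _ _).comp
        ((hη X).over_liftIso _ _ _))).whiskerRight _).comp ((Over.associator _ _ _).comp
      ((((Over.associator _ _ _).inv.comp ((((Over.rightUnitor _).comp
        (Over.leftUnitor _).inv).whiskerRight _).comp ((Over.associator _ _ _).comp
        (((over_counitNaturality hη _).whiskerLeft _).comp
          (Over.associator _ _ _).inv)))).whiskerLeft _).comp (Over.associator _ _ _).inv)))).comp
      ((over_leftTriangleApp hη X).whiskerRight _))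
    (by
      simp only [Iso.trans_hom, whiskerLeftIso_hom, Iso.symm_hom, Iso.refl_inv, Iso.refl_hom]
      -- These are the identities over which the two `mapComp` constraints lie.
      erw [Category.comp_id, Category.id_comp]
      bicategory)

/-- The right triangle lives in C, where `IsBiuniversal.ext` does not apply. Its naturality is
instead the square equation `o` of the counit constraint, solved for the inverses of `ζ` and `ζ'`.
Abstract 1-morphisms keep the constraints of G out of the coherence argument. -/
theorem triangle_of_counit {C : Type u₂} [Bicategory.{w₂, v₂} C] {X X' E E' : C} {x : X ⟶ X'}
    {e : X ⟶ E} {e' : X' ⟶ E'} {m : E ⟶ E'} {k : E ⟶ X} {k' : E' ⟶ X'} (ν : x ≫ e' ≅ e ≫ m)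
    (ζ : 𝟙 X ≫ 𝟙 X ≅ e ≫ k) (ζ' : 𝟙 X' ≫ 𝟙 X' ≅ e' ≫ k') (n : m ≫ k' ⟶ k ≫ x)
    (o : (α_ _ _ _).hom ≫ x ◁ ζ'.hom ≫ (α_ _ _ _).inv ≫ ν.hom ▷ k' ≫ (α_ _ _ _).hom ≫ e ◁ n =
      ((ρ_ x).hom ≫ (λ_ x).inv) ▷ _ ≫ (α_ _ _ _).hom ≫ 𝟙 X ◁ ((ρ_ x).hom ≫ (λ_ x).inv) ≫
        (α_ _ _ _).inv ≫ ζ.hom ▷ x ≫ (α_ _ _ _).hom) :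
    x ◁ (whiskerLeftIso e' (λ_ k') ≪≫ ζ'.symm ≪≫ λ_ _).hom ≫ (ρ_ x).hom ≫ (λ_ x).inv =
    ((α_ _ _ _).inv ≫ ν.hom ▷ _ ≫ (α_ _ _ _).hom ≫
      e ◁ ((α_ _ _ _).inv ≫ ((ρ_ _).hom ≫ (λ_ _).inv) ▷ _ ≫ (α_ _ _ _).hom ≫
        𝟙 _ ◁ n ≫ (α_ _ _ _).inv) ≫ (α_ _ _ _).inv) ≫
    (whiskerLeftIso e (λ_ k) ≪≫ ζ.symm ≪≫ λ_ _).hom ▷ x := by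
  rw [← cancel_epi (x ◁ (e' ◁ (λ_ k').inv)), ← cancel_epi (x ◁ ζ'.hom),
    ← cancel_epi (α_ _ _ _).hom]
  have o' := o =≫ ((α_ _ _ _).inv ≫ ζ.inv ▷ x)
  have : x ◁ e' ◁ (λ_ k').inv ≫ ((α_ _ _ _).inv ≫ ν.hom ▷ _ ≫ (α_ _ _ _).hom ≫
      e ◁ ((α_ _ _ _).inv ≫ ((ρ_ _).hom ≫ (λ_ _).inv) ▷ _ ≫ (α_ _ _ _).hom ≫
        𝟙 _ ◁ n ≫ (α_ _ _ _).inv) ≫ (α_ _ _ _).inv) ≫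
      (whiskerLeftIso e (λ_ k) ≪≫ ζ.symm ≪≫ λ_ _).hom ▷ x =
      ((α_ _ _ _).inv ≫ ν.hom ▷ k' ≫ (α_ _ _ _).hom ≫ e ◁ n) ≫
        ((α_ _ _ _).inv ≫ ζ.inv ▷ x) ≫ (λ_ _).hom ▷ x := by
    simp only [Iso.trans_hom, whiskerLeftIso_hom, Iso.symm_hom]
    bicategory
  rw [this]
  simp only [Category.assoc] at o' ⊢
  rw [reassoc_of% o']
  simp

/-- The component of the right triangle modification. -/
noncomputable def rightTriangleApp (b : B) :
    η (G.obj b) ≫ 𝟙 (G.obj (M (G.obj b))) ≫ G.map (counitApp hη b) ≅ 𝟙 (G.obj b) :=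
  whiskerLeftIso (η (G.obj b)) (λ_ _) ≪≫ (counitSq hη b).symm ≪≫ λ_ _

theorem rightTriangleApp_naturality {a b : B} (h : a ⟶ b) :
    G.map h ◁ (rightTriangleApp hη b).hom ≫ (ρ_ (G.map h)).hom ≫ (λ_ (G.map h)).inv =
    ((α_ _ _ _).inv ≫ ((hη (G.obj a)).sq (G.map h) (η (G.obj b))).hom ▷ _ ≫ (α_ _ _ _).hom ≫
      _ ◁ ((α_ _ _ _).inv ≫ ((ρ_ _).hom ≫ (λ_ _).inv) ▷ _ ≫ (α_ _ _ _).hom ≫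
        _ ◁ ((G.mapComp ((leftBiadjoint hη).map (G.map h)) (counitApp hη b)).inv ≫
          G.map₂ (counitNaturality hη h).hom ≫ (G.mapComp (counitApp hη a) h).hom) ≫
        (α_ _ _ _).inv) ≫
      (α_ _ _ _).inv) ≫
    (rightTriangleApp hη a).hom ▷ G.map h := by
  have o := over_counitNaturality hη h
  refine triangle_of_counit _ _ _ _ ?_
  -- Composing with this constraint cancels the inverse one in the target square and completes the
  -- 2-morphism `n` of `triangle_of_counit`.
  have o' := o =≫ (η (G.obj a) ◁ (G.mapComp (counitApp hη a) h).hom)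
  simp only [Sq.comp, Iso.trans_hom, Iso.symm_hom, whiskerLeftIso_hom, whiskerRightIso_hom,
    Category.assoc, whiskerLeft_inv_hom, Category.comp_id] at o'
  simp only [← Bicategory.whiskerLeft_comp] at o'
  exact o'

/-- The biadjunction given by a choice of biuniversal arrows. -/
noncomputable def leftBiadjointBiadjunction : Biadjunction (leftBiadjoint hη) G where
  unit := leftBiadjointUnit hη
  counit := leftBiadjointCounit hη
  leftTriangle := Pseudofunctor.StrongTrans.isoMk (fun X => leftTriangleApp hη X) (by
    intro X Y f
    exact leftTriangleApp_naturality hη f)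
  rightTriangle := Pseudofunctor.StrongTrans.isoMk (fun b => rightTriangleApp hη b) (by
    intro a b h
    exact rightTriangleApp_naturality hη h)

end LeftBiadjoint

/-! ### Inverters and full faithfulness -/

section Inverters

variable {C : Type u₁} [Bicategory.{w₁, v₁} C] {W X₀ X₁ X₂ : C} {f₁ f₂ : X₁ ⟶ X₂} {φ : f₁ ⟶ f₂}
  {f₀ : X₀ ⟶ X₁}

theorem isIso_whiskerLeft_of_iso {f g : W ⟶ X₁} (e : f ≅ g) (h : IsIso (f ◁ φ)) :
    IsIso (g ◁ φ) := by
  have : g ◁ φ = e.inv ▷ f₁ ≫ f ◁ φ ≫ e.hom ▷ f₂ := by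
    rw [whisker_exchange, ← comp_whiskerRight_assoc]
    simp
  rw [this]
  infer_instance

theorem IsInverter.faithful (hi : IsInverter φ f₀) (W : C) : (postcomp W f₀).Faithful := by
  have := hi.universal W
  exact inferInstanceAs (toInvCone W φ hi.cone ⋙ (invCone W φ).ι).Faithful

theorem IsInverter.full (hi : IsInverter φ f₀) (W : C) : (postcomp W f₀).Full := by
  have := hi.universal W
  exact inferInstanceAs (toInvCone W φ hi.cone ⋙ (invCone W φ).ι).Full

theorem IsInverter.exists_lift (hi : IsInverter φ f₀) (f : W ⟶ X₁) (hf : IsIso (f ◁ φ)) :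
    ∃ g : W ⟶ X₀, Nonempty (g ≫ f₀ ≅ f) := by
  have := hi.universal W
  exact ⟨_, ⟨(invCone W φ).ι.mapIso ((toInvCone W φ hi.cone).objObjPreimageIso ⟨f, hf⟩)⟩⟩

/-- The inverter cones form a full subcategory, so full faithfulness can be tested in Hom(W, X₁). -/
theorem isInverter_of_exists_lift (cone : invCone X₀ φ f₀)
    (faithful : ∀ W, (postcomp W f₀).Faithful) (full : ∀ W, (postcomp W f₀).Full)
    (lift : ∀ (W : C) (f : W ⟶ X₁), IsIso (f ◁ φ) → ∃ g : W ⟶ X₀, Nonempty (g ≫ f₀ ≅ f)) :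
    IsInverter φ f₀ where
  cone := cone
  universal W :=
    { faithful := by
        have := faithful W
        exact Functor.Faithful.of_comp_iso
          ((invCone W φ).liftCompιIso (postcomp W f₀) (invCone_comp φ cone))
      full := by
        have := full W
        exact Functor.Full.of_comp_faithful_iso
          ((invCone W φ).liftCompιIso (postcomp W f₀) (invCone_comp φ cone))
      essSurj := ⟨fun f => by
        obtain ⟨g, ⟨e⟩⟩ := lift W f.obj f.property
        exact ⟨g, ⟨ObjectProperty.isoMk _ e⟩⟩⟩ }

/-- Composition with an inverter is fully faithful. Hence the premise of assumption 4 always holds.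
-/
theorem IsInverter.isPseudomonic (hi : IsInverter φ f₀) : IsPseudomonic f₀ where
  faithful := hi.faithful
  full_on_isos W g h e := by
    have := hi.faithful W
    have := hi.full W
    exact ⟨(postcomp W f₀).preimageIso e, Iso.ext ((postcomp W f₀).map_preimage e.hom)⟩

theorem isIso_of_isIso_whiskerRight (hi : IsInverter φ f₀) {g h : W ⟶ X₀} (β : g ⟶ h)
    (hβ : IsIso (β ▷ f₀)) : IsIso β := by
  have := hi.faithful W
  have := hi.full W
  have : IsIso ((postcomp W f₀).map β) := hβ
  exact isIso_of_reflects_iso β (postcomp W f₀)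

end Inverters

/-! ### Local objects and the reflection onto them -/

section Local

variable {C : Type u₁} [Bicategory.{w₁, v₁} C]

/-- The part of the structure of a pseudonatural transformation `Ψ : ID ⇒ T` and a modification
`Ψ_T ⇛ T Ψ` that does not involve the coherence equations. -/
structure Pointing (T : C ⥤ᵖ C) where
  /-- The components of `Ψ`. -/
  app (X : C) : X ⟶ T.obj X
  /-- The naturality constraints of `Ψ`. -/
  naturality {X Y : C} (f : X ⟶ Y) : f ≫ app Y ≅ app X ≫ T.map f
  naturality_naturality {X Y : C} {f g : X ⟶ Y} (η : f ⟶ g) :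
    η ▷ app Y ≫ (naturality g).hom = (naturality f).hom ≫ app X ◁ T.map₂ η
  /-- The components of the modification. -/
  mod (X : C) : app (T.obj X) ⟶ T.map (app X)
  -- Any isomorphisms i and j suffice, because the equation only serves to transport invertibility.
  mod_naturality {X Y : C} (f : X ⟶ Y) :
    ∃ (i : T.map f ≫ app (T.obj Y) ≅ app (T.obj X) ≫ T.map (T.map f))
      (j : T.map f ≫ T.map (app Y) ≅ T.map (app X) ≫ T.map (T.map f)),
      T.map f ◁ mod Y ≫ j.hom = i.hom ≫ mod X ▷ T.map (T.map f)

/-- The `Pointing` underlying `Ψ : ID ⇒ T` and `μ : Ψ_T ⇛ T Ψ`. -/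
def Pointing.ofModification {T : C ⥤ᵖ C} (Ψ : Pseudofunctor.id C ⟶ T)
    (μ : preWhiskerUnit T Ψ ⟶ postWhiskerUnit Ψ T) : Pointing T where
  app X := Ψ.app X
  naturality f := Ψ.naturality f
  naturality_naturality η := Ψ.naturality_naturality η
  mod X := μ.as.app X
  mod_naturality f := ⟨(preWhiskerUnit T Ψ).naturality f, (postWhiskerUnit Ψ T).naturality f,
    μ.as.naturality f⟩

namespace Pointing

variable {T : C ⥤ᵖ C} (P : Pointing T)

theorem isIso_whiskerLeft_map {W X Y : C} (f : X ⟶ Y) (g : W ⟶ T.obj X)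
    (h : IsIso (g ◁ P.mod X)) : IsIso ((g ≫ T.map f) ◁ P.mod Y) := by
  obtain ⟨i, j, w⟩ := P.mod_naturality f
  have w' : T.map f ◁ P.mod Y = i.hom ≫ P.mod X ▷ T.map (T.map f) ≫ j.inv := by
    rw [← Category.assoc, ← w]
    simp
  rw [Bicategory.comp_whiskerLeft, w']
  have : g ◁ P.mod X ▷ T.map (T.map f) =
      (α_ _ _ _).inv ≫ (g ◁ P.mod X) ▷ T.map (T.map f) ≫ (α_ _ _ _).hom := by simp
  simp only [Bicategory.whiskerLeft_comp, this]
  infer_instance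

/-- By naturality of Ψ at `f`, composing with `f` and then Ψ_Y is conjugate to composing with Ψ_X
and then T f. For f = Λ this carries full faithfulness over to Ψ_M. -/
theorem whiskerRight_whiskerRight_app {W X Y : C} (f : X ⟶ Y) {g h : W ⟶ X} (γ : g ⟶ h) :
    (γ ▷ f) ▷ P.app Y =
      (α_ _ _ _).hom ≫ g ◁ (P.naturality f).hom ≫ (α_ _ _ _).inv ≫ (γ ▷ P.app X) ▷ T.map f ≫
        (α_ _ _ _).hom ≫ h ◁ (P.naturality f).inv ≫ (α_ _ _ _).inv := by
  rw [associator_naturality_left_assoc, ← whisker_exchange_assoc]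
  simp

theorem isIso_whiskerRight_app {W X Y : C} {f g : X ⟶ Y} (η : f ⟶ g) (v : W ⟶ X)
    (h : IsIso ((v ≫ P.app X) ◁ T.map₂ η)) : IsIso ((v ◁ η) ▷ P.app Y) := by
  have : (v ◁ η) ▷ P.app Y = (α_ _ _ _).hom ≫ v ◁ (P.naturality f).hom ≫ (α_ _ _ _).inv ≫
      ((v ≫ P.app X) ◁ T.map₂ η) ≫ (α_ _ _ _).hom ≫ v ◁ (P.naturality g).inv ≫ (α_ _ _ _).inv := by
    have w : η ▷ P.app Y =
        (P.naturality f).hom ≫ P.app X ◁ T.map₂ η ≫ (P.naturality g).inv := by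
      rw [← Category.assoc, ← P.naturality_naturality]
      simp
    simp [w]
  rw [this]
  infer_instance

variable {X M : C} {Λ : M ⟶ T.obj X} {θ : X ⟶ M}

/-- Both sides agree after composition with TΛ, through the inverse of Λ ◁ μ_X; pseudomonicity then
cancels TΛ. -/
theorem nonempty_app_iso (hΛ : IsInverter (P.mod X) Λ) (hT : IsPseudomonic (T.map Λ))
    (e : θ ≫ Λ ≅ P.app X) : Nonempty (Λ ≫ T.map θ ≅ P.app M) := by
  have := hΛ.cone
  have : IsIso (Λ ◁ P.mod X) := this
  obtain ⟨e', -⟩ := hT.full_on_isos M (Λ ≫ T.map θ) (P.app M)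
    (α_ _ _ _ ≪≫ whiskerLeftIso Λ ((T.mapComp θ Λ).symm ≪≫ T.map₂Iso e) ≪≫
      (asIso (Λ ◁ P.mod X)).symm ≪≫ P.naturality Λ)
  exact ⟨e'⟩

/-- An object `X` is local if `Ψ_X` is an inverter of `μ_X`. -/
def IsLocal (X : C) : Prop := IsInverter (P.mod X) (P.app X)

/-- The quasi-inverse K sends f to the lift of Λ ≫ T f through Ψ_Y. Both comparisons with the
identity are constructed after composition with Ψ_Y, which is fully faithful on 1-morphisms into Y.
-/
theorem isEquivalence_precomp (hΛ : IsInverter (P.mod X) Λ) (hT : IsPseudomonic (T.map Λ))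
    (e : θ ≫ Λ ≅ P.app X) {Y : C} (hY : P.IsLocal Y) : (precomp Y θ).IsEquivalence := by
  obtain ⟨σ⟩ := P.nonempty_app_iso hΛ hT e
  have := hY.universal M
  let K₀ : (X ⟶ Y) ⥤ (invCone M (P.mod Y)).FullSubcategory :=
    (invCone M (P.mod Y)).lift (T.mapFunctor X Y ⋙ precomp _ Λ)
      fun f => P.isIso_whiskerLeft_map f Λ hΛ.cone
  let K : (X ⟶ Y) ⥤ (M ⟶ Y) := K₀ ⋙ (toInvCone M (P.mod Y) hY.cone).inv
  let κ : K ⋙ postcomp M (P.app Y) ≅ T.mapFunctor X Y ⋙ precomp _ Λ :=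
    Functor.isoWhiskerRight (Functor.isoWhiskerLeft K₀
      (toInvCone M (P.mod Y) hY.cone).asEquivalence.counitIso) (invCone M (P.mod Y)).ι
  obtain ⟨k, hk⟩ : ∃ k : ∀ f, K.obj f ≫ P.app Y ≅ Λ ≫ T.map f, ∀ {f f' : X ⟶ Y} (η : f ⟶ f'),
      K.map η ▷ P.app Y ≫ (k f').hom = (k f).hom ≫ Λ ◁ T.map₂ η :=
    ⟨fun f => κ.app f, fun η => κ.hom.naturality η⟩
  have hf (W : C) := hY.faithful W
  have hF (W : C) := hY.full W
  -- For f = θ ≫ g, the isomorphism σ turns Λ ≫ T θ ≫ T g into Ψ_M ≫ T g ≅ g ≫ Ψ_Y.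
  let i₁ : precomp Y θ ⋙ K ≅ 𝟭 (M ⟶ Y) :=
    Functor.fullyFaithfulCancelRight (postcomp M (P.app Y))
      (Functor.isoWhiskerLeft (precomp Y θ) κ ≪≫
        NatIso.ofComponents (fun g => whiskerLeftIso Λ (T.mapComp θ g) ≪≫ (α_ _ _ _).symm ≪≫
          whiskerRightIso σ (T.map g) ≪≫ (P.naturality g).symm) (by
            intro g g' η
            change Λ ◁ T.map₂ (θ ◁ η) ≫ Λ ◁ (T.mapComp θ g').hom ≫ (α_ _ _ _).inv ≫
              σ.hom ▷ T.map g' ≫ (P.naturality g').inv =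
              (Λ ◁ (T.mapComp θ g).hom ≫ (α_ _ _ _).inv ≫
              σ.hom ▷ T.map g ≫ (P.naturality g).inv) ≫ η ▷ P.app Y
            rw [← cancel_mono (P.naturality g').hom]
            simp only [Pseudofunctor.map₂_whisker_left, Bicategory.whiskerLeft_comp,
              Category.assoc, whiskerLeft_inv_hom_assoc, Iso.inv_hom_id, Category.comp_id,
              P.naturality_naturality, Iso.inv_hom_id_assoc]
            rw [associator_inv_naturality_right_assoc, whisker_exchange]))
  -- Here θ ≫ Λ ≫ T f ≅ Ψ_X ≫ T f ≅ f ≫ Ψ_Y, by `e`.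
  let i₂ : K ⋙ precomp Y θ ≅ 𝟭 (X ⟶ Y) :=
    Functor.fullyFaithfulCancelRight (postcomp X (P.app Y))
      (NatIso.ofComponents (fun f => α_ _ _ _ ≪≫ whiskerLeftIso θ (k f) ≪≫ (α_ _ _ _).symm ≪≫
          whiskerRightIso e (T.map f) ≪≫ (P.naturality f).symm) (by
            intro f f' η
            change (θ ◁ K.map η) ▷ P.app Y ≫ (α_ _ _ _).hom ≫ θ ◁ (k f').hom ≫ (α_ _ _ _).inv ≫
              e.hom ▷ T.map f' ≫ (P.naturality f').inv =
              ((α_ _ _ _).hom ≫ θ ◁ (k f).hom ≫ (α_ _ _ _).inv ≫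
              e.hom ▷ T.map f ≫ (P.naturality f).inv) ≫ η ▷ P.app Y
            rw [← cancel_mono (P.naturality f').hom]
            have hκ' := congrArg (fun t => θ ◁ t) (hk η)
            simp only [Bicategory.whiskerLeft_comp] at hκ'
            simp only [Category.assoc, Iso.inv_hom_id, Category.comp_id, P.naturality_naturality,
              Iso.inv_hom_id_assoc, associator_naturality_middle_assoc, reassoc_of% hκ']
            rw [associator_inv_naturality_right_assoc, whisker_exchange]))
  exact (CategoryTheory.Equivalence.mk (precomp Y θ) K i₁.symm i₂).isEquivalence_functor

/-- Everything is compared along Ψ_M ≫ TΛ ≅ Λ ≫ Ψ_{TX}, whose right-hand side is fully faithful.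
Faithfulness of Ψ_M is immediate, fullness uses that TΛ is faithful, and lifts come from lifting
first through Ψ_{TX} and then through Λ. -/
theorem isLocal_of_isInverter (hΛ : IsInverter (P.mod X) Λ) (hT : IsPseudomonic (T.map Λ))
    (hM : IsIso (P.app M ◁ P.mod M)) (hX : P.IsLocal (T.obj X))
    (hTX : P.IsLocal (T.obj (T.obj X))) : P.IsLocal M := by
  have hfaithful (W : C) : (postcomp W (P.app M)).Faithful := ⟨by
    intro g h β β' w
    change β ▷ P.app M = β' ▷ P.app M at w
    have h1 := hΛ.faithful W
    have h2 := hX.faithful W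
    apply (postcomp W Λ).map_injective
    apply (postcomp W (P.app (T.obj X))).map_injective
    change (β ▷ Λ) ▷ P.app (T.obj X) = (β' ▷ Λ) ▷ P.app (T.obj X)
    rw [P.whiskerRight_whiskerRight_app, P.whiskerRight_whiskerRight_app, w]⟩
  refine isInverter_of_exists_lift hM hfaithful (fun W => ⟨?_⟩) ?_
  · intro g h α
    have h1 := hΛ.full W
    have h2 := hX.full W
    have h3 := hT.faithful W
    change g ≫ P.app M ⟶ h ≫ P.app M at α
    obtain ⟨β', hβ'⟩ : ∃ β' : g ≫ Λ ⟶ h ≫ Λ, β' ▷ P.app (T.obj X) =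
        (α_ _ _ _).hom ≫ g ◁ (P.naturality Λ).hom ≫ (α_ _ _ _).inv ≫
          α ▷ T.map Λ ≫ (α_ _ _ _).hom ≫ h ◁ (P.naturality Λ).inv ≫ (α_ _ _ _).inv :=
      (postcomp W (P.app (T.obj X))).map_surjective _
    obtain ⟨β, rfl⟩ : ∃ β : g ⟶ h, β ▷ Λ = β' := (postcomp W Λ).map_surjective β'
    refine ⟨β, (postcomp W (T.map Λ)).map_injective ?_⟩
    change (β ▷ P.app M) ▷ T.map Λ = α ▷ T.map Λ
    rw [P.whiskerRight_whiskerRight_app] at hβ'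
    rw [cancel_epi, cancel_epi, cancel_epi] at hβ'
    exact (cancel_mono _).1 hβ'
  · intro W w hw
    have h1 := P.isIso_whiskerLeft_map Λ w hw
    obtain ⟨v, ⟨ev⟩⟩ := hX.exists_lift _ h1
    -- Since TTX is local, invertibility of v ◁ μ_X may be tested after Ψ_{TTX}. There it becomes
    -- that of T(μ_X) restricted along v ≫ Ψ_{TX} ≅ w ≫ TΛ, and Λ inverts μ_X.
    have hv : IsIso (v ◁ P.mod X) := by
      apply isIso_of_isIso_whiskerRight hTX
      apply P.isIso_whiskerRight_app
      refine isIso_whiskerLeft_of_iso ev.symm ?_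
      have : IsIso (Λ ◁ P.mod X) := hΛ.cone
      have : IsIso (T.map Λ ◁ T.map₂ (P.mod X)) := by
        have h : T.map Λ ◁ T.map₂ (P.mod X) =
            (T.mapComp _ _).inv ≫ T.map₂ (Λ ◁ P.mod X) ≫ (T.mapComp _ _).hom := by simp
        rw [h]
        infer_instance
      rw [Bicategory.comp_whiskerLeft]
      infer_instance
    obtain ⟨u, ⟨eu⟩⟩ := hΛ.exists_lift v hv
    -- The lift is correct after composition with TΛ, and TΛ is full on isomorphisms.
    obtain ⟨e', -⟩ := hT.full_on_isos W (u ≫ P.app M) w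
      (α_ _ _ _ ≪≫ whiskerLeftIso u (P.naturality Λ).symm ≪≫ (α_ _ _ _).symm ≪≫
        whiskerRightIso eu _ ≪≫ ev)
    exact ⟨u, ⟨e'⟩⟩

end Pointing

end Local

/-! ### From reflections to the left biadjoint of G -/

section Main

variable {B : Type u₂} [Bicategory.{w₂, v₂} B] {C : Type u₃} [Bicategory.{w₃, v₃} C]

theorem isEquivalence_precomp_of_equivalence {X Y : C} (e : X ≌ Y) (Z : C) :
    (precomp Z e.hom).IsEquivalence :=
  (CategoryTheory.Equivalence.mk (precomp Z e.hom) (precomp Z e.inv)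
    ((leftUnitorNatIso Y Z).symm ≪≫ (precomposing Y Y Z).mapIso e.counit.symm ≪≫
      associatorNatIsoRight e.inv e.hom Z)
    ((associatorNatIsoRight e.hom e.inv Z).symm ≪≫ (precomposing X X Z).mapIso e.unit.symm ≪≫
      leftUnitorNatIso X Z)).isEquivalence_functor

/-- On 1-morphisms into G c, the local functor of G, composition with `e` and composition with `θ`
are all equivalences. -/
theorem isBiuniversal_comp {G : B ⥤ᵖ C} (hG : IsFullyFaithful G) {X M' : C} {b : B} (θ : X ⟶ M')
    (hθ : ∀ Y, InEssImage G Y → (precomp Y θ).IsEquivalence) (e : M' ≌ G.obj b) :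
    IsBiuniversal (G := G) (θ ≫ e.hom) := by
  intro c
  have := hθ (G.obj c) ⟨c, ⟨Equivalence.id _⟩⟩
  have := isEquivalence_precomp_of_equivalence e (G.obj c)
  have := hG b c
  have : (precomp (G.obj c) (θ ≫ e.hom)).IsEquivalence :=
    Functor.isEquivalence_of_iso (F := precomp (G.obj c) e.hom ⋙ precomp (G.obj c) θ)
      (associatorNatIsoRight θ e.hom (G.obj c)).symm
  infer_instance

/-- The symmetric equivalence. -/
def equivalenceSymm {X Y : C} (e : X ≌ Y) : Y ≌ X :=
  Equivalence.mkOfAdjointifyCounit e.counit.symm e.unit.symm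

/-- The component of an invertible modification. -/
def modificationIsoApp {F F' : B ⥤ᵖ C} {η θ : F ⟶ F'} (Γ : η ≅ θ) (b : B) : η.app b ≅ θ.app b where
  hom := Γ.hom.as.app b
  inv := Γ.inv.as.app b
  hom_inv_id := congrArg (fun m => m.as.app b) Γ.hom_inv_id
  inv_hom_id := congrArg (fun m => m.as.app b) Γ.inv_hom_id

/-- The component of a pseudonatural equivalence. -/
def equivalenceApp {F F' : B ⥤ᵖ C} (Γ : F ≌ F') (b : B) : F.obj b ≌ F'.obj b :=
  Equivalence.mkOfAdjointifyCounit (f := Γ.hom.app b) (g := Γ.inv.app b)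
    (modificationIsoApp Γ.unit b) (modificationIsoApp Γ.counit b)

end Main

end BicatInverter

theorem mainTheorem3
    {A : Type u₁} [Bicategory.{w₁, v₁} A]
    {B : Type u₂} [Bicategory.{w₂, v₂} B]
    {C : Type u₃} [Bicategory.{w₃, v₃} C]
    -- the triangle of biadjunctions
    (F : A ⥤ᵖ B) (L : B ⥤ᵖ A) (_adjLF : BicatInverter.Biadjunction L F)
    (H : A ⥤ᵖ C) (N : C ⥤ᵖ A) (adjNH : BicatInverter.Biadjunction N H)
    (G : B ⥤ᵖ C) (_Γ : F.comp G ≌ H)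
    (hG : BicatInverter.IsFullyFaithful G)
    -- the modification `Ψ_{HN} ⇛ (HN) Ψ` and its pointwise inverters
    (μ' : BicatInverter.preWhiskerUnit (N.comp H) adjNH.unit ⟶ BicatInverter.postWhiskerUnit adjNH.unit (N.comp H))
    (M' : C → C) (Λ' : ∀ X : C, M' X ⟶ (N.comp H).obj X)
    (hΛ' : ∀ X : C, BicatInverter.IsInverter (μ'.as.app X) (Λ' X))
    (hμΨ : IsIso (adjNH.unit ◁ μ'))
    (hess : ∀ X : C, BicatInverter.InEssImage G X ↔ BicatInverter.IsInverter (μ'.as.app X) (adjNH.unit.app X))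
    (hpm : ∀ X : C, BicatInverter.IsPseudomonic (Λ' X) → BicatInverter.IsPseudomonic ((N.comp H).map (Λ' X))) :
    (∀ X : C, BicatInverter.InEssImage G (M' X)) ∧
      ∀ M : C → B, (∀ X : C, Nonempty (G.obj (M X) ≌ M' X)) →
        ∃ MM : C ⥤ᵖ B, (∀ X : C, MM.obj X = M X) ∧ Nonempty (BicatInverter.Biadjunction MM G) := by
  let T := N.comp H
  let P := BicatInverter.Pointing.ofModification adjNH.unit μ'
  have hloc (X : C) : BicatInverter.InEssImage G X ↔ P.IsLocal X := hess X
  -- TX = H(NX) is equivalent to G(F(NX)).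
  have hT (X : C) : P.IsLocal (T.obj X) :=
    (hloc _).1 ⟨_, ⟨BicatInverter.equivalenceApp _Γ (N.obj X)⟩⟩
  have hpT (X : C) : BicatInverter.IsPseudomonic (T.map (Λ' X)) :=
    hpm X (hΛ' X).isPseudomonic
  have hΨ (X : C) : IsIso (P.app X ◁ P.mod X) :=
    (BicatInverter.modificationIsoApp (asIso (adjNH.unit ◁ μ')) X).isIso_hom
  have hM (X : C) : P.IsLocal (M' X) :=
    P.isLocal_of_isInverter (hΛ' X) (hpT X) (hΨ _) (hT X) (hT _)
  refine ⟨fun X => (hloc _).2 (hM X), fun M hMM => ?_⟩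
  -- By assumption 2, Ψ_X inverts μ_X and so lifts through its inverter.
  choose θ hθ using fun X => (hΛ' X).exists_lift (P.app X) (hΨ X)
  let e (X : C) : M' X ≌ G.obj (M X) := BicatInverter.equivalenceSymm (hMM X).some
  have hη (X : C) : BicatInverter.IsBiuniversal (G := G) (θ X ≫ (e X).hom) :=
    BicatInverter.isBiuniversal_comp hG (θ X)
      (fun Y hY => P.isEquivalence_precomp (hΛ' X) (hpT X) (hθ X).some ((hloc Y).1 hY)) (e X)
  exact ⟨BicatInverter.leftBiadjoint hη, fun _ => rfl,
    ⟨BicatInverter.leftBiadjointBiadjunction hη⟩⟩
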